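/- For a domain $D\subset\mathbb C^n$, $z,w\in D$ and $X\in\mathbb C^n$, let $$g_D(z,w)=\sup\{u(w):u\in\mathrm{PSH}(D),\ u<0,\ u\le\log\|\cdot-z\|+C\text{ on }D\text{ for some }C\in\mathbb R\}$$ be the pluricomplex Green function, $$A_D(z;X)=\limsup_{\lambda\to0,\ \lambda\ne 0}\frac{\exp g_D(z,z+\lambda X)}{|\lambda|}$$ the Azukawa metric, and $$S_D(z;X)=\sup_v\,[\mathcal L_v(z;X)]^{1/2}$$ the Sibony metric, where $\mathcal L_v(z;X)=\sum_{j,k}\frac{\partial^2 v}{\partial z_j\partial\bar z_k}(z)X_j\overline{X_k}$ is the Levi form and $v$ runs over all functions $v:D\to[0,1)$ such that $v(z)=0$, $\log v$ is plurisubharmonic on $D$ and $v$ is of class $C^2$ near $z$. For $M\in\{A,S\}$ let $V^M_D(z)\in[0,\infty]$ be the Lebesgue measure of the indicatrix $\{X\in\mathbb C^n:M_D(z;X)<1\}$. Let $D=\{z\in\mathbb C^2:1<|z_1|+|z_2|<2\}$. Then: 1. $D$ is a bounded domain which has Lipschitz boundary near each of its boundary points, and $(1,0)\in\partial D$. (Lipschitz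 boundary near $p\in\partial D$ means that, after an isometric real-linear change of coordinates of $\mathbb C^n=\mathbb R^{2n}$, $D$ coincides near $p$ with the region $\{t<f(y)\}$, $(t,y)\in\mathbb R\times\mathbb R^{2n-1}$, for a real-valued Lipschitz function $f$.) 2. There are constants $C<\infty$ and $\delta>0$ such that $A_D((x,0);X)\le C$ for all $x\in(1,1+\delta)$ and all $X\in\mathbb C^2$ with $\|X\|=1$; that is, $\limsup_{x\to1^+}A_D((x,0);X)<\infty$ uniformly in the unit vectors $X$. 3. In particular, $\liminf_{x\to1^+}V^A_D((x,0))>0$. 4. Hence neither $V^A_D(z)$ nor $V^S_D(z)$ tends to $0$ as $z\to(1,0)$, $z\in D$. So the assertion "if $D$ is a bounded domain in $\mathbb C^n$ with $C^1$ boundary near $p\in\partial D$, then $\lim_{z\to p}V^S_D(z)=0$" becomes false, even for $V^A_D$, when $C^1$ is replaced by Lipschitz. -/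

import Mathlib

open Filter Topology MeasureTheory
open scoped ENNReal NNReal

noncomputable section

/-- `ℂⁿ` with its Euclidean norm and Lebesgue measure. -/
abbrev Cn (n : ℕ) := EuclideanSpace ℂ (Fin n)

/-- The logarithm of a nonnegative real number, with `log 0 = -∞`. -/
def elog (t : ℝ) : EReal := ENNReal.log (ENNReal.ofReal t)

/-- The mean value of `u` over the circle `{a + e^{iθ} b}`, as the mean of the positive part
minus the mean of the negative part. For `u < +∞` upper semicontinuous on the circle, `u` is
measurable and bounded above there, so this is the usual mean, with value in `[-∞, +∞)`. -/
def circleMean {n : ℕ} (u : Cn n → EReal) (a b : Cn n) : EReal :=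
  ((⨍⁻ θ : ℝ, (u (a + Complex.exp (θ * Complex.I) • b)).toENNReal
      ∂(volume.restrict (Set.Ioc 0 (2 * Real.pi))) : ℝ≥0∞) : EReal)
    - ((⨍⁻ θ : ℝ, (-u (a + Complex.exp (θ * Complex.I) • b)).toENNReal
      ∂(volume.restrict (Set.Ioc 0 (2 * Real.pi))) : ℝ≥0∞) : EReal)

/-- `u` is plurisubharmonic on the open set `D`: it takes values in `[-∞, +∞)`, is upper
semicontinuous, and satisfies the sub-mean value inequality on every closed affine complex disc
contained in `D`. (The constant `-∞` is allowed.) Values of `u` outside `D` play no role. -/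
structure IsPSH {n : ℕ} (D : Set (Cn n)) (u : Cn n → EReal) : Prop where
  lt_top : ∀ w ∈ D, u w < ⊤
  usc : UpperSemicontinuousOn u D
  le_circleMean : ∀ a b : Cn n, (∀ t : ℂ, ‖t‖ ≤ 1 → a + t • b ∈ D) → u a ≤ circleMean u a b

/-- The negative plurisubharmonic functions on `D` with a logarithmic pole at `z`. The bound is
non-strict because both of its sides are `-∞` at `w = z`. -/
def greenClass {n : ℕ} (D : Set (Cn n)) (z : Cn n) : Set (Cn n → EReal) :=
  {u | IsPSH D u ∧ (∀ w ∈ D, u w < 0) ∧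
    ∃ C : ℝ, ∀ w ∈ D, u w ≤ elog ‖w - z‖ + (C : EReal)}

/-- The pluricomplex Green function of `D` with pole at `z`. -/
def pluricomplexGreen {n : ℕ} (D : Set (Cn n)) (z w : Cn n) : EReal :=
  ⨆ u ∈ greenClass D z, u w

/-- The Azukawa metric `A_D(z; X)`. -/
def azukawa {n : ℕ} (D : Set (Cn n)) (z X : Cn n) : ℝ≥0∞ :=
  limsup (fun t : ℂ => EReal.exp (pluricomplexGreen D z (z + t • X)) / ENNReal.ofReal ‖t‖)
    (𝓝[≠] 0)

/-- The Wirtinger derivative `∂f/∂z_j = (∂f/∂x_j - i ∂f/∂y_j) / 2`. -/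
def wirtinger {n : ℕ} (j : Fin n) (f : Cn n → ℂ) (w : Cn n) : ℂ :=
  (1 / 2) * (fderiv ℝ f w (EuclideanSpace.single j 1)
    - Complex.I * fderiv ℝ f w (EuclideanSpace.single j Complex.I))

/-- The Wirtinger derivative `∂f/∂z̄_j = (∂f/∂x_j + i ∂f/∂y_j) / 2`. -/
def wirtingerBar {n : ℕ} (j : Fin n) (f : Cn n → ℂ) (w : Cn n) : ℂ :=
  (1 / 2) * (fderiv ℝ f w (EuclideanSpace.single j 1)
    + Complex.I * fderiv ℝ f w (EuclideanSpace.single j Complex.I))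

/-- The Levi form `∑ j k, ∂²v/∂z_j∂z̄_k (z) X_j conj(X_k)` of a real function `v` (the sum is
real where `v` is of class `C²`). -/
def leviForm {n : ℕ} (v : Cn n → ℝ) (z X : Cn n) : ℝ :=
  (∑ j : Fin n, ∑ k : Fin n,
    wirtinger j (wirtingerBar k (fun w => (v w : ℂ))) z * X j * (starRingEnd ℂ) (X k)).re

/-- The functions `v : D → [0, 1)` with `v z = 0` and `log v` plurisubharmonic on `D` that are of
class `C²` near `z`. -/
def sibonyClass {n : ℕ} (D : Set (Cn n)) (z : Cn n) : Set (Cn n → ℝ) :=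
  {v | (∀ w ∈ D, 0 ≤ v w ∧ v w < 1) ∧ v z = 0 ∧ IsPSH D (fun w => elog (v w)) ∧
    ContDiffAt ℝ 2 v z}

/-- The Sibony metric `S_D(z; X)`. -/
def sibony {n : ℕ} (D : Set (Cn n)) (z X : Cn n) : ℝ≥0∞ :=
  ⨆ v ∈ sibonyClass D z, ENNReal.ofReal (Real.sqrt (leviForm v z X))

/-- The volume of the indicatrix of the Azukawa metric at `z`. -/
def volAzukawa {n : ℕ} (D : Set (Cn n)) (z : Cn n) : ℝ≥0∞ :=
  volume {X : Cn n | azukawa D z X < 1}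

/-- The volume of the indicatrix of the Sibony metric at `z`. -/
def volSibony {n : ℕ} (D : Set (Cn n)) (z : Cn n) : ℝ≥0∞ :=
  volume {X : Cn n | sibony D z X < 1}

/-- `D` has Lipschitz boundary near `p`: for some real direction `e`, near `p` the set `D` is the
region strictly below the graph, in the direction `e`, of a Lipschitz function of the orthogonal
projection onto the real hyperplane orthogonal to `e`. -/
def LipschitzBoundaryNear {n : ℕ} (D : Set (Cn n)) (p : Cn n) : Prop :=
  ∃ e : Cn n, ‖e‖ = 1 ∧ ∃ (K : ℝ≥0) (f : Cn n → ℝ), LipschitzWith K f ∧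
    ∀ᶠ w in 𝓝 p, (w ∈ D ↔ inner ℝ e w < f (w - (inner ℝ e w) • e))

/-- The domain `{1 < |z₁| + |z₂| < 2}` in `ℂ²`. -/
def shellDomain : Set (Cn 2) := {z | 1 < ‖z 0‖ + ‖z 1‖ ∧ ‖z 0‖ + ‖z 1‖ < 2}

/-- The point `(x, 0)` of `ℂ²`. -/
def axisPoint (x : ℝ) : Cn 2 := !₂[(x : ℂ), 0]

end

/-! The inner boundary sphere `|z₁| + |z₂| = 1` is pseudoconcave, and at `(1, 0)` it has an edge
sharp enough that discs of fixed size survive as `x → 1`. If `|Y₀| ≤ |Y₁|`, then `|x + sY₀| + |sY₁|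
≥ x > 1`, so the disc through `(x, 0)` in direction `Y` leaves the shell only through the outer
boundary, and its radius does not shrink. A Schwarz lemma for negative plurisubharmonic functions
with a logarithmic pole (`IsPSH.le_log_div`) then gives a uniform bound in these directions.

For `|X₀| > |X₁|`, fix a small `t` and move `(x, 0) + tX` over a disc in the second coordinate whose
boundary points lie in the good directions. The maximum principle transfers the bound to the centre
(`IsPSH.le_log_near_axisPoint`). This needs `|t| < (x - 1)/‖X‖`, which is harmless because both
metrics see only `t → 0`.

The pole has weight `m`: `m = 1` gives the Azukawa bound. For Sibony competitors, a `C²` function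
vanishing at its minimum is quadratically small, so `m = 2` applies to `log v`, and the resulting
growth bound controls the Hessian and hence the Levi form. Both metrics are at most `4‖X‖/(2 - x)`,
so both indicatrices contain a fixed punctured ball. -/

/-! ### Sub-mean value inequality and the Schwarz lemma -/

/-- Positive and negative parts are compared separately. Continuity of `h` makes both of its
integrals finite, so the `EReal` difference of its parts is the ordinary integral. -/
theorem circleMean_le_circleAverage {n : ℕ} {u : Cn n → EReal} {h : ℂ → ℝ} {a b : Cn n} {c : ℂ}
    {s : ℝ} (hc : ContinuousOn h (Metric.sphere c |s|))
    (hu : ∀ t ∈ Metric.sphere c |s|, u (a + t • b) ≤ (h t : EReal)) :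
    circleMean u (a + c • b) ((s : ℂ) • b) ≤ ((Real.circleAverage h c s : ℝ) : EReal) := by
  set μ : Measure ℝ := volume.restrict (Set.Ioc 0 (2 * Real.pi)) with hμ
  have hci : CircleIntegrable h c s := hc.circleIntegrable'
  have hint : Integrable (fun θ : ℝ => h (circleMap c s θ)) ((μ Set.univ)⁻¹ • μ) := by
    have h1 : IntegrableOn (fun θ : ℝ => h (circleMap c s θ)) (Set.Ioc 0 (2 * Real.pi)) :=
      (intervalIntegrable_iff_integrableOn_Ioc_of_le (by positivity)).1 hci
    refine Integrable.smul_measure h1 ?_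
    simp [hμ, Real.pi_pos]
  have havg : Real.circleAverage h c s = ∫ θ, h (circleMap c s θ) ∂((μ Set.univ)⁻¹ • μ) := by
    rw [Real.circleAverage_eq_intervalAverage, Set.uIoc_of_le (by positivity)]
    rfl
  have hpt : ∀ θ : ℝ, u (a + c • b + Complex.exp (θ * Complex.I) • ((s : ℂ) • b))
      ≤ (h (circleMap c s θ) : EReal) := by
    intro θ
    have : a + c • b + Complex.exp (θ * Complex.I) • ((s : ℂ) • b) = a + circleMap c s θ • b := by
      simp only [circleMap, add_smul, smul_smul, add_assoc, mul_comm]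
    rw [this]
    exact hu _ (circleMap_mem_sphere' c s θ)
  have hpos : (⨍⁻ θ : ℝ, (u (a + c • b + Complex.exp (θ * Complex.I) • ((s : ℂ) • b))).toENNReal ∂μ)
      ≤ ∫⁻ θ, ENNReal.ofReal (h (circleMap c s θ)) ∂((μ Set.univ)⁻¹ • μ) :=
    lintegral_mono fun θ => by
      simpa using EReal.toENNReal_le_toENNReal (hpt θ)
  have hneg : ∫⁻ θ, ENNReal.ofReal (-h (circleMap c s θ)) ∂((μ Set.univ)⁻¹ • μ)
      ≤ (⨍⁻ θ : ℝ, (-u (a + c • b + Complex.exp (θ * Complex.I) • ((s : ℂ) • b))).toENNReal ∂μ) :=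
    lintegral_mono fun θ => by
      have := EReal.toENNReal_le_toENNReal (EReal.neg_le_neg_iff.2 (hpt θ))
      rw [← EReal.coe_neg] at this
      simpa using this
  have h1 : ∫⁻ θ, ENNReal.ofReal (h (circleMap c s θ)) ∂((μ Set.univ)⁻¹ • μ) ≠ ∞ :=
    hint.lintegral_lt_top.ne
  have h2 : ∫⁻ θ, ENNReal.ofReal (-h (circleMap c s θ)) ∂((μ Set.univ)⁻¹ • μ) ≠ ∞ :=
    hint.neg.lintegral_lt_top.ne
  rw [havg, integral_eq_lintegral_pos_part_sub_lintegral_neg_part hint, EReal.coe_sub]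
  refine (EReal.sub_le_sub (EReal.coe_ennreal_le_coe_ennreal_iff.2 hpos)
    (EReal.coe_ennreal_le_coe_ennreal_iff.2 hneg)).trans (le_of_eq ?_)
  rw [EReal.coe_ennreal_toReal h1, EReal.coe_ennreal_toReal h2]

/-- Sub-mean value inequality against a majorant that is harmonic on the disc. -/
theorem IsPSH.le_of_le_harmonic {n : ℕ} {D : Set (Cn n)} {u : Cn n → EReal} (hu : IsPSH D u)
    {h : ℂ → ℝ} {a b : Cn n} {c : ℂ} {s : ℝ} (hs : 0 ≤ s)
    (hD : ∀ t ∈ Metric.closedBall c s, a + t • b ∈ D)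
    (hh : InnerProductSpace.HarmonicOnNhd h (Metric.closedBall c s))
    (hle : ∀ t ∈ Metric.sphere c s, u (a + t • b) ≤ (h t : EReal)) :
    u (a + c • b) ≤ (h c : EReal) := by
  have h1 := hu.le_circleMean (a + c • b) ((s : ℂ) • b) (by
    intro t ht
    have : a + c • b + t • ((s : ℂ) • b) = a + (c + t * s) • b := by
      simp only [add_smul, smul_smul, add_assoc]
    rw [this]
    refine hD _ ?_
    simpa [Metric.mem_closedBall, dist_eq_norm, abs_of_nonneg hs] using
      mul_le_mul_of_nonneg_right ht hs)
  refine h1.trans ?_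
  have habs := abs_of_nonneg hs
  rw [← InnerProductSpace.HarmonicOnNhd.circleAverage_eq (f := h) (c := c) (R := s)
    (by rwa [habs])]
  refine circleMean_le_circleAverage ?_ (by rwa [habs])
  intro t ht
  rw [habs] at ht
  exact ((hh t (Metric.sphere_subset_closedBall ht)).1.continuousAt).continuousWithinAt

/-- Comparison on a punctured disc of a plurisubharmonic function having a pole at the centre with
a barrier that is strictly superharmonic. -/
theorem IsPSH.le_barrier {n : ℕ} {D : Set (Cn n)} {u : Cn n → EReal} (hu : IsPSH D u)
    {a b : Cn n} {r m C ε δ : ℝ} (hr : 0 < r) (hε : 0 < ε) (hδ : 0 < δ)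
    (hD : ∀ t : ℂ, ‖t‖ ≤ r → a + t • b ∈ D) (hneg : ∀ w ∈ D, u w ≤ 0)
    (hpole : ∀ᶠ t : ℂ in 𝓝[≠] 0, u (a + t • b) ≤ ((m * Real.log ‖t‖ + C : ℝ) : EReal))
    {t : ℂ} (ht0 : t ≠ 0) (htr : ‖t‖ ≤ r) :
    u (a + t • b) ≤
      (((m - ε) * (Real.log ‖t‖ - Real.log r) + δ * (r ^ 2 - ‖t‖ ^ 2) : ℝ) : EReal) := by
  set H : ℂ → ℝ := fun t =>
    (m - ε) * (Real.log ‖t‖ - Real.log r) + δ * (r ^ 2 - ‖t‖ ^ 2) with hH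
  have hbound : u (a + t • b) < ⊤ := hu.lt_top _ (hD t htr)
  -- Weakening the weight from `m` to `m - ε` gains `-ε log ‖t‖ → +∞`, which absorbs the constant
  -- `C`.
  have hnear : ∀ᶠ t : ℂ in 𝓝[≠] 0, u (a + t • b) ≤ (H t : EReal) := by
    have hlog : Tendsto (fun t : ℂ => Real.log ‖t‖) (𝓝[≠] 0) atBot :=
      Real.tendsto_log_nhdsGT_zero.comp tendsto_norm_nhdsNE_zero
    have hsmall : ∀ᶠ t : ℂ in 𝓝[≠] 0, ‖t‖ ≤ r := by
      refine nhdsWithin_le_nhds ?_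
      filter_upwards [Metric.closedBall_mem_nhds (0 : ℂ) hr] with t ht
      simpa using ht
    filter_upwards [hpole, hsmall,
      hlog.eventually_le_atBot ((-(m - ε) * Real.log r - C) / ε)] with t h1 h2 h3
    refine h1.trans (EReal.coe_le_coe_iff.2 ?_)
    rw [le_div_iff₀ hε] at h3
    have h4 : 0 ≤ δ * (r ^ 2 - ‖t‖ ^ 2) :=
      mul_nonneg hδ.le (sub_nonneg.2 (pow_le_pow_left₀ (norm_nonneg t) h2 2))
    simp only [hH]
    linarith
  obtain ⟨ρ, hρ, hρle⟩ := Metric.eventually_nhds_iff_ball.1 (eventually_nhdsWithin_iff.1 hnear)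
  by_contra hcon
  rw [not_le] at hcon
  set η := min ρ ‖t‖ with hη
  have hηpos : 0 < η := lt_min hρ (norm_pos_iff.2 ht0)
  -- `u ≤ H` already holds for `0 < ‖s‖ < η`, so a positive maximum of `u - H` has modulus at least
  -- `η`; the inner radius `η / 2` leaves room for a disc around it.
  let A : Set ℂ := {s | η / 2 ≤ ‖s‖ ∧ ‖s‖ ≤ r}
  have hA0 : ∀ s ∈ A, s ≠ 0 := fun s hs => norm_pos_iff.1 (by linarith [hs.1])
  have hAc : IsCompact A := by
    refine Metric.isCompact_of_isClosed_isBounded ?_ ?_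
    · exact (isClosed_le continuous_const continuous_norm).inter
        (isClosed_le continuous_norm continuous_const)
    · exact (Metric.isBounded_closedBall (x := (0 : ℂ)) (r := r)).subset fun s hs => by
        simpa using hs.2
  have hHc : ContinuousOn H {0}ᶜ := by
    have h1 : ContinuousOn (fun s : ℂ => Real.log ‖s‖) {0}ᶜ :=
      continuous_norm.continuousOn.log fun s hs => norm_ne_zero_iff.2 hs
    fun_prop
  have husc : UpperSemicontinuousOn (fun s : ℂ => u (a + s • b) + ((-H s : ℝ) : EReal)) A := by
    refine UpperSemicontinuousOn.add' ?_ ?_ ?_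
    · have hc : ContinuousOn (fun s : ℂ => a + s • b) A := by fun_prop
      exact hu.usc.comp hc fun s hs => hD s hs.2
    · refine ContinuousOn.upperSemicontinuousOn ?_
      exact continuous_coe_real_ereal.comp_continuousOn
        (hHc.mono fun s hs => hA0 s hs).neg
    · intro s _
      exact EReal.continuousAt_add (Or.inr (EReal.coe_ne_bot _)) (Or.inr (EReal.coe_ne_top _))
  have htA : t ∈ A := ⟨by linarith [min_le_right ρ ‖t‖], htr⟩
  obtain ⟨c, hcA, hcmax⟩ := husc.exists_isMaxOn ⟨t, htA⟩ hAc
  have hlt : ∀ s : ℂ, s ∈ A → u (a + s • b) ≠ ⊤ := fun s hs => (hu.lt_top _ (hD s hs.2)).ne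
  -- the maximum is a positive real number
  have htpos : (0 : EReal) < u (a + t • b) + ((-H t : ℝ) : EReal) := by
    induction h : u (a + t • b) with
    | bot => simp [h] at hcon
    | top => exact absurd h (hlt t htA)
    | coe x =>
      rw [h] at hcon
      have := EReal.coe_lt_coe_iff.1 hcon
      rw [← EReal.coe_add]
      exact_mod_cast (by simp only [hH]; linarith : (0 : ℝ) < x + -H t)
  have hcpos := htpos.trans_le (hcmax htA)
  obtain ⟨U, hU⟩ : ∃ U : ℝ, u (a + c • b) = U := by
    induction h : u (a + c • b) with
    | bot => simp [h] at hcpos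
    | top => exact absurd h (hlt c hcA)
    | coe x => exact ⟨x, rfl⟩
  have hM : 0 < U - H c := by
    simp only [hU, ← EReal.coe_add] at hcpos
    have : (0 : ℝ) < U + -H c := by exact_mod_cast hcpos
    linarith
  have hmax : ∀ s ∈ A, u (a + s • b) ≤ ((H s + (U - H c) : ℝ) : EReal) := by
    intro s hs
    have h1 := hcmax hs
    simp only [Set.mem_ofPred_eq, hU, ← EReal.coe_add] at h1
    induction h : u (a + s • b) with
    | bot => exact bot_le
    | top => exact absurd h (hlt s hs)
    | coe x =>
      rw [h, ← EReal.coe_add, EReal.coe_le_coe_iff] at h1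
      exact EReal.coe_le_coe_iff.2 (by linarith)
  -- the maximum is attained in the interior of the annulus
  have hcr : ‖c‖ < r := by
    refine lt_of_le_of_ne hcA.2 fun h => ?_
    have h1 := hneg _ (hD c hcA.2)
    rw [hU] at h1
    have h2 : U ≤ 0 := by exact_mod_cast h1
    have h3 : H c = 0 := by simp [hH, h]
    linarith
  have hcη : η ≤ ‖c‖ := by
    by_contra h
    rw [not_le] at h
    have h1 := hρle c (by simpa using h.trans_le (min_le_left _ _)) (hA0 c hcA)
    rw [hU, EReal.coe_le_coe_iff] at h1
    linarith
  set s := min (η / 2) (r - ‖c‖) with hs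
  have hspos : 0 < s := lt_min (by linarith) (by linarith)
  have hball : Metric.closedBall c s ⊆ A := by
    intro w hw
    rw [Metric.mem_closedBall, dist_eq_norm] at hw
    have h1 := norm_sub_norm_le w c
    have h2 := norm_sub_norm_le c w
    rw [norm_sub_rev] at h2
    have h3 := min_le_left (η / 2) (r - ‖c‖)
    have h4 := min_le_right (η / 2) (r - ‖c‖)
    exact ⟨by linarith, by linarith⟩
  -- On the circle `‖w - c‖ = s`, `‖w‖ ^ 2` equals a real-affine function of `w`. Substituting it
  -- makes the barrier harmonic without changing it on the circle, but lowers it by `δ * s ^ 2` at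
  -- the centre, which contradicts maximality.
  let h : ℂ → ℝ := ((m - ε) • (fun w : ℂ => Real.log ‖w‖)
      - δ • (fun w : ℂ => (2 * (starRingEnd ℂ) c * w).re))
      + fun _ => - (m - ε) * Real.log r + δ * (r ^ 2 - s ^ 2 + ‖c‖ ^ 2) + (U - H c)
  have hharm : InnerProductSpace.HarmonicOnNhd h (Metric.closedBall c s) := by
    intro w hw
    refine ((InnerProductSpace.HarmonicAt.const_smul ?_).sub
      (InnerProductSpace.HarmonicAt.const_smul ?_)).add (InnerProductSpace.harmonicAt_const _)
    · exact AnalyticAt.harmonicAt_log_norm analyticAt_id (hA0 w (hball hw))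
    · exact AnalyticAt.harmonicAt_re (f := fun w : ℂ => 2 * (starRingEnd ℂ) c * w) (by fun_prop)
  have hfinal := hu.le_of_le_harmonic (a := a) (b := b) hspos.le
    (fun w hw => hD w (hball hw).2) hharm (by
      intro w hw
      refine (hmax w (hball (Metric.sphere_subset_closedBall hw))).trans
        (EReal.coe_le_coe_iff.2 (le_of_eq ?_))
      rw [mem_sphere_iff_norm] at hw
      have h1 : ‖w‖ ^ 2 = (2 * (starRingEnd ℂ) c * w).re + s ^ 2 - ‖c‖ ^ 2 := by
        rw [← hw, ← Complex.normSq_eq_norm_sq, ← Complex.normSq_eq_norm_sq,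
          ← Complex.normSq_eq_norm_sq]
        simp [Complex.normSq_apply]
        ring
      have h2 : H w = (m - ε) * (Real.log ‖w‖ - Real.log r) + δ * (r ^ 2 - ‖w‖ ^ 2) := rfl
      rw [h2, h1]
      simp only [h, Pi.add_apply, Pi.sub_apply, Pi.smul_apply, smul_eq_mul]
      ring)
  rw [hU, EReal.coe_le_coe_iff] at hfinal
  have h1 : (2 * (starRingEnd ℂ) c * c).re = 2 * ‖c‖ ^ 2 := by
    rw [← Complex.normSq_eq_norm_sq]
    simp [Complex.normSq_apply]
    ring
  have h2 : h c = U - δ * s ^ 2 := by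
    have h3 : H c = (m - ε) * (Real.log ‖c‖ - Real.log r) + δ * (r ^ 2 - ‖c‖ ^ 2) := rfl
    simp only [h, Pi.add_apply, Pi.sub_apply, Pi.smul_apply, smul_eq_mul, h1, h3]
    ring
  have : 0 < δ * s ^ 2 := by positivity
  linarith

/-- A Schwarz lemma: a nonpositive plurisubharmonic function with a logarithmic pole of weight `m`
at the centre of a disc of radius `R` is bounded by `m * log (‖t‖ / R)` on that disc. -/
theorem IsPSH.le_log_div {n : ℕ} {D : Set (Cn n)} {u : Cn n → EReal} (hu : IsPSH D u)
    {a b : Cn n} {R m C : ℝ} (hD : ∀ t : ℂ, ‖t‖ < R → a + t • b ∈ D) (hneg : ∀ w ∈ D, u w ≤ 0)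
    (hpole : ∀ᶠ t : ℂ in 𝓝[≠] 0, u (a + t • b) ≤ ((m * Real.log ‖t‖ + C : ℝ) : EReal))
    {t : ℂ} (ht0 : t ≠ 0) (htR : ‖t‖ < R) :
    u (a + t • b) ≤ ((m * Real.log (‖t‖ / R) : ℝ) : EReal) := by
  have htpos : 0 < ‖t‖ := norm_pos_iff.2 ht0
  have hRpos : 0 < R := htpos.trans htR
  have hnt : u (a + t • b) ≠ ⊤ := (hu.lt_top _ (hD t htR)).ne
  induction h : u (a + t • b) with
  | bot => exact bot_le
  | top => exact absurd h hnt
  | coe U =>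
    rw [EReal.coe_le_coe_iff, Real.log_div htpos.ne' hRpos.ne']
    -- The barrier needs a closed disc in `D`, hence `r < R`. Both barrier parameters are set to the
    -- same `ε → 0`, and `r → R` comes last.
    have key : ∀ r ∈ Set.Ico ‖t‖ R, U ≤ m * (Real.log ‖t‖ - Real.log r) := by
      intro r hr
      have hlim : Tendsto (fun ε : ℝ => (m - ε) * (Real.log ‖t‖ - Real.log r)
          + ε * (r ^ 2 - ‖t‖ ^ 2)) (𝓝[>] 0) (𝓝 (m * (Real.log ‖t‖ - Real.log r))) := by
        have hc : Continuous (fun ε : ℝ => (m - ε) * (Real.log ‖t‖ - Real.log r)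
          + ε * (r ^ 2 - ‖t‖ ^ 2)) := by fun_prop
        have := hc.tendsto 0
        simp only [sub_zero, zero_mul, add_zero] at this
        exact this.mono_left nhdsWithin_le_nhds
      refine ge_of_tendsto hlim ?_
      filter_upwards [self_mem_nhdsWithin] with ε hε
      have := hu.le_barrier (htpos.trans_le hr.1) hε hε
        (fun s hs => hD s (hs.trans_lt hr.2)) hneg hpole ht0 hr.1
      rwa [h, EReal.coe_le_coe_iff] at this
    have hlim : Tendsto (fun r : ℝ => m * (Real.log ‖t‖ - Real.log r)) (𝓝[<] R)
        (𝓝 (m * (Real.log ‖t‖ - Real.log R))) := by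
      have hc : ContinuousAt (fun r : ℝ => m * (Real.log ‖t‖ - Real.log r)) R := by
        have := Real.continuousAt_log hRpos.ne'
        fun_prop
      exact hc.tendsto.mono_left nhdsWithin_le_nhds
    refine ge_of_tendsto hlim ?_
    filter_upwards [Ico_mem_nhdsLT htR] with r hr using key r hr

/-! ### Analytic discs through `(x, 0)` and the Azukawa bound -/

@[simp] theorem axisPoint_apply_zero (x : ℝ) : axisPoint x 0 = x := by simp [axisPoint]

@[simp] theorem axisPoint_apply_one (x : ℝ) : axisPoint x 1 = 0 := by simp [axisPoint]

theorem axisPoint_add_smul_mem_shellDomain {x κ : ℝ} (hx1 : 1 < x) (hκ : 0 < κ)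
    {Y : Cn 2} (hY : ‖Y 0‖ ≤ ‖Y 1‖) (hYκ : ‖Y 0‖ + ‖Y 1‖ ≤ κ) {s : ℂ}
    (hs : ‖s‖ < (2 - x) / κ) : axisPoint x + s • Y ∈ shellDomain := by
  have hx : ‖(x : ℂ)‖ = x := by rw [Complex.norm_real, Real.norm_of_nonneg (by linarith)]
  rw [lt_div_iff₀ hκ] at hs
  have h1 : ‖s‖ * ‖Y 0‖ ≤ ‖s‖ * ‖Y 1‖ := mul_le_mul_of_nonneg_left hY (norm_nonneg s)
  have h2 : ‖s‖ * (‖Y 0‖ + ‖Y 1‖) ≤ ‖s‖ * κ := mul_le_mul_of_nonneg_left hYκ (norm_nonneg s)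
  have h3 := norm_add_le (x : ℂ) (s * Y 0)
  have h4 := norm_sub_le ((x : ℂ) + s * Y 0) (s * Y 0)
  rw [add_sub_cancel_right] at h4
  simp only [norm_mul, hx] at h3 h4
  constructor <;> simp only [PiLp.add_apply, PiLp.smul_apply, axisPoint_apply_zero,
    axisPoint_apply_one, smul_eq_mul, zero_add, norm_mul] <;> linarith

/-- Bound along the discs that stay in the shell since `|x + s Y₀| + |s Y₁| ≥ x`. -/
theorem IsPSH.le_log_on_vertical_disc {u : Cn 2 → EReal} (hu : IsPSH shellDomain u)
    (hneg : ∀ w ∈ shellDomain, u w ≤ 0) {x m C κ : ℝ} (hx1 : 1 < x)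
    (hpole : ∀ᶠ w in 𝓝[≠] axisPoint x,
      u w ≤ ((m * Real.log ‖w - axisPoint x‖ + C : ℝ) : EReal))
    (hκ : 0 < κ) {Y : Cn 2} (hY0 : Y ≠ 0) (hY : ‖Y 0‖ ≤ ‖Y 1‖) (hYκ : ‖Y 0‖ + ‖Y 1‖ ≤ κ)
    {s : ℂ} (hs0 : s ≠ 0) (hs : ‖s‖ < (2 - x) / κ) :
    u (axisPoint x + s • Y) ≤ ((m * Real.log (κ * ‖s‖ / (2 - x)) : ℝ) : EReal) := by
  have hlim : Tendsto (fun t : ℂ => axisPoint x + t • Y) (𝓝[≠] 0) (𝓝[≠] axisPoint x) := by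
    refine tendsto_nhdsWithin_iff.2 ⟨?_, ?_⟩
    · have hc : Continuous fun t : ℂ => axisPoint x + t • Y := by fun_prop
      have := hc.tendsto 0
      simp only [zero_smul, add_zero] at this
      exact this.mono_left nhdsWithin_le_nhds
    · filter_upwards [self_mem_nhdsWithin] with t ht
      simpa using ⟨ht, hY0⟩
  have hp : ∀ᶠ t : ℂ in 𝓝[≠] 0, u (axisPoint x + t • Y) ≤
      ((m * Real.log ‖t‖ + (m * Real.log ‖Y‖ + C) : ℝ) : EReal) := by
    filter_upwards [hlim.eventually hpole, self_mem_nhdsWithin] with t ht ht0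
    refine ht.trans (EReal.coe_le_coe_iff.2 (le_of_eq ?_))
    rw [add_sub_cancel_left, norm_smul,
      Real.log_mul (norm_ne_zero_iff.2 ht0) (norm_ne_zero_iff.2 hY0)]
    ring
  have h := hu.le_log_div
    (fun t ht => axisPoint_add_smul_mem_shellDomain hx1 hκ hY hYκ ht) hneg hp hs0 hs
  rwa [div_div_eq_mul_div, mul_comm ‖s‖ κ] at h

/-- Near the concave part of the boundary, a nonpositive plurisubharmonic function with a
logarithmic pole at `(x, 0)` is bounded above in all directions by a logarithm whose constant does
not degenerate as `x → 1`. -/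
theorem IsPSH.le_log_near_axisPoint {u : Cn 2 → EReal} (hu : IsPSH shellDomain u)
    (hneg : ∀ w ∈ shellDomain, u w ≤ 0) {x m C : ℝ} (hx1 : 1 < x)
    (hpole : ∀ᶠ w in 𝓝[≠] axisPoint x,
      u w ≤ ((m * Real.log ‖w - axisPoint x‖ + C : ℝ) : EReal))
    {X : Cn 2} (hX : X ≠ 0) {t : ℂ} (ht0 : t ≠ 0) (ht1 : ‖t‖ < (x - 1) / ‖X‖)
    (ht2 : ‖t‖ < (2 - x) / (4 * ‖X‖)) :
    u (axisPoint x + t • X) ≤ ((m * Real.log (4 * ‖X‖ * ‖t‖ / (2 - x)) : ℝ) : EReal) := by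
  have hXpos : 0 < ‖X‖ := norm_pos_iff.2 hX
  have hX0 : ‖X 0‖ ≤ ‖X‖ := PiLp.norm_apply_le X 0
  have hX1 : ‖X 1‖ ≤ ‖X‖ := PiLp.norm_apply_le X 1
  rcases le_or_gt ‖X 0‖ ‖X 1‖ with h01 | h01
  · exact hu.le_log_on_vertical_disc hneg hx1 hpole (by positivity) hX h01 (by linarith) ht0 ht2
  have ha : 0 < ‖X 0‖ := (norm_nonneg _).trans_lt h01
  have hx : ‖(x : ℂ)‖ = x := by rw [Complex.norm_real, Real.norm_of_nonneg (by linarith)]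
  let e : Cn 2 := EuclideanSpace.single 1 1
  have hsplit : ∀ w : ℂ, axisPoint x + t • X + w • t • e = axisPoint x + t • (X + w • e) := by
    intro w
    rw [smul_add, smul_comm w t e, add_assoc]
  -- For `‖w‖ = 2‖X 0‖`, `‖X 1 + w‖ ≥ 2‖X 0‖ - ‖X 1‖ ≥ ‖X 0‖`, so `X + w • e` is a good direction,
  -- and its coordinate norms add up to at most `4‖X‖`. The majorant is constant on this disc.
  have h := hu.le_of_le_harmonic (a := axisPoint x + t • X) (b := t • e) (c := 0)
    (s := 2 * ‖X 0‖) (h := fun _ => m * Real.log (4 * ‖X‖ * ‖t‖ / (2 - x))) (by positivity)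
    ?_ (fun _ _ => InnerProductSpace.harmonicAt_const _) ?_
  · simpa using h
  · intro w hw
    -- The first coordinate is the same on the whole disc and has modulus at least `x - ‖t‖ * ‖X‖ >
    -- 1`, which keeps the disc off the hole.
    rw [mem_closedBall_zero_iff] at hw
    rw [lt_div_iff₀ hXpos] at ht1
    rw [lt_div_iff₀ (by positivity)] at ht2
    have h1 := norm_add_le (x : ℂ) (t * X 0)
    have h2 := norm_sub_le ((x : ℂ) + t * X 0) (t * X 0)
    have h3 := norm_add_le (X 1) w
    rw [add_sub_cancel_right] at h2
    simp only [norm_mul, hx] at h1 h2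
    have h4 : ‖t‖ * ‖X 0‖ ≤ ‖t‖ * ‖X‖ := mul_le_mul_of_nonneg_left hX0 (norm_nonneg t)
    have h5 : ‖t‖ * ‖X 1 + w‖ ≤ ‖t‖ * (3 * ‖X‖) :=
      mul_le_mul_of_nonneg_left (by linarith) (norm_nonneg t)
    have h6 : 0 ≤ ‖t‖ * ‖X 1 + w‖ := by positivity
    rw [hsplit]
    constructor <;> simp [e] <;> rw [← mul_add t (X 1) w, norm_mul] <;> linarith
  · intro w hw
    rw [mem_sphere_zero_iff_norm] at hw
    rw [hsplit]
    have h1 := norm_add_le (X 1) w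
    have h2 := norm_sub_le (X 1 + w) (X 1)
    rw [add_sub_cancel_left] at h2
    refine hu.le_log_on_vertical_disc hneg hx1 hpole (by positivity) ?_ ?_ ?_ ht0 ht2
    · intro h0
      have : (X + w • e) 0 = 0 := by rw [h0]; rfl
      simp [e] at this
      simp [this] at ha
    · simp [e]
      linarith
    · simp [e]
      linarith

theorem eventually_norm_lt_nhdsNE_zero {r : ℝ} (hr : 0 < r) : ∀ᶠ t : ℂ in 𝓝[≠] 0, ‖t‖ < r := by
  refine nhdsWithin_le_nhds ?_
  filter_upwards [Metric.ball_mem_nhds (0 : ℂ) hr] with t ht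
  simpa using ht

theorem azukawa_shellDomain_axisPoint_le {x : ℝ} (hx1 : 1 < x) (hx2 : x < 2) {X : Cn 2}
    (hX : X ≠ 0) :
    azukawa shellDomain (axisPoint x) X ≤ ENNReal.ofReal (4 * ‖X‖ / (2 - x)) := by
  have hXpos : 0 < ‖X‖ := norm_pos_iff.2 hX
  refine limsup_le_of_le (h := ?_)
  filter_upwards [self_mem_nhdsWithin,
    eventually_norm_lt_nhdsNE_zero (r := (x - 1) / ‖X‖) (by apply div_pos <;> linarith),
    eventually_norm_lt_nhdsNE_zero (r := (2 - x) / (4 * ‖X‖)) (by apply div_pos <;> linarith)]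
    with t ht0 ht1 ht2
  have htpos : 0 < ‖t‖ := norm_pos_iff.2 ht0
  refine ENNReal.div_le_of_le_mul ?_
  have hpos : 0 < 4 * ‖X‖ * ‖t‖ / (2 - x) := div_pos (by positivity) (by linarith)
  have hg : pluricomplexGreen shellDomain (axisPoint x) (axisPoint x + t • X) ≤
      ((Real.log (4 * ‖X‖ * ‖t‖ / (2 - x)) : ℝ) : EReal) := by
    refine iSup₂_le ?_
    rintro u ⟨hu, hneg, C, hC⟩
    have h := hu.le_log_near_axisPoint (fun w hw => (hneg w hw).le) (m := 1) (C := C) hx1 ?_ hX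
      ht0 ht1 ht2
    · simpa using h
    have hmem : ∀ᶠ w in 𝓝 (axisPoint x), w ∈ shellDomain := by
      have hx : ‖(x : ℂ)‖ = x := by rw [Complex.norm_real, Real.norm_of_nonneg (by linarith)]
      have hc : Continuous fun w : Cn 2 => ‖w 0‖ + ‖w 1‖ := by fun_prop
      have hlim := hc.tendsto (axisPoint x)
      simp only [axisPoint_apply_zero, axisPoint_apply_one, norm_zero, add_zero, hx] at hlim
      exact (hlim.eventually_const_lt hx1).and (hlim.eventually_lt_const hx2)
    filter_upwards [nhdsWithin_le_nhds hmem, self_mem_nhdsWithin] with w hw hw0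
    have h1 := hC w hw
    rwa [elog, ENNReal.log_ofReal_of_pos (norm_pos_iff.2 (sub_ne_zero.2 hw0)),
      ← EReal.coe_add, ← one_mul (Real.log _)] at h1
  refine (EReal.exp_monotone hg).trans (le_of_eq ?_)
  rw [EReal.exp_coe, Real.exp_log hpos, ← ENNReal.ofReal_mul (div_nonneg (by positivity)
    (by linarith))]
  congr 1
  ring

/-! ### Topology of the shell -/

theorem continuous_shell_gauge : Continuous fun w : Cn 2 => ‖w 0‖ + ‖w 1‖ := by fun_prop

theorem isOpen_shellDomain : IsOpen shellDomain :=
  (isOpen_lt continuous_const continuous_shell_gauge).inter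
    (isOpen_lt continuous_shell_gauge continuous_const)

theorem isBounded_shellDomain : Bornology.IsBounded shellDomain := by
  refine (Metric.isBounded_closedBall (x := (0 : Cn 2)) (r := 2)).subset fun w hw => ?_
  rw [mem_closedBall_zero_iff, EuclideanSpace.norm_eq, Fin.sum_univ_two]
  refine Real.sqrt_le_iff.2 ⟨by norm_num, ?_⟩
  nlinarith [norm_nonneg (w 0), norm_nonneg (w 1), hw.2]

theorem shell_gauge_pos {w : Cn 2} (hw : w ≠ 0) : 0 < ‖w 0‖ + ‖w 1‖ := by
  by_contra h
  have h0 : w 0 = 0 := norm_le_zero_iff.1 (by linarith [norm_nonneg (w 1)])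
  have h1 : w 1 = 0 := norm_le_zero_iff.1 (by linarith [norm_nonneg (w 0)])
  exact hw (by ext i; fin_cases i <;> simp [h0, h1])

/-- The shell is the continuous image of `(1, 2) × (ℂ² ∖ {0})` under rescaling a vector to a
prescribed gauge. -/
theorem isConnected_shellDomain : IsConnected shellDomain := by
  have hrank : 1 < Module.rank ℝ (Cn 2) := by
    rw [← Module.finrank_eq_rank, ← Module.finrank_mul_finrank ℝ ℂ (Cn 2)]
    simp
  have h1 := (isConnected_compl_singleton_of_one_lt_rank hrank (0 : Cn 2))
  have h2 : IsConnected (Set.Ioo (1 : ℝ) 2) := isConnected_Ioo (by norm_num)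
  have himg : shellDomain =
      (fun q : ℝ × Cn 2 => ((q.1 / (‖q.2 0‖ + ‖q.2 1‖) : ℝ) : ℂ) • q.2) ''
        (Set.Ioo (1 : ℝ) 2 ×ˢ ({0}ᶜ : Set (Cn 2))) := by
    ext w
    constructor
    · intro hw
      have hw0 : w ≠ 0 := by
        rintro rfl
        have := hw.1
        simp at this
        linarith
      refine ⟨(‖w 0‖ + ‖w 1‖, w), ⟨hw, hw0⟩, ?_⟩
      simp only
      rw [div_self (shell_gauge_pos hw0).ne', Complex.ofReal_one, one_smul]
    · rintro ⟨⟨r, y⟩, ⟨hr, hy⟩, rfl⟩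
      have hy' := shell_gauge_pos hy
      have hr0 : 0 < r := by linarith [hr.1]
      have key : ‖((((r / (‖y 0‖ + ‖y 1‖) : ℝ) : ℂ) • y : Cn 2)) 0‖ +
          ‖((((r / (‖y 0‖ + ‖y 1‖) : ℝ) : ℂ) • y : Cn 2)) 1‖ = r := by
        simp only [PiLp.smul_apply, smul_eq_mul, norm_mul, Complex.norm_real,
          Real.norm_of_nonneg (div_nonneg hr0.le hy'.le), ← mul_add]
        exact div_mul_cancel₀ r hy'.ne'
      exact ⟨by rw [key]; exact hr.1, by rw [key]; exact hr.2⟩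
  rw [himg]
  refine (h2.prod h1).image _ ?_
  have hc : ContinuousOn (fun q : ℝ × Cn 2 => q.1 / (‖q.2 0‖ + ‖q.2 1‖))
      (Set.Ioo (1 : ℝ) 2 ×ˢ ({0}ᶜ : Set (Cn 2))) := by
    refine ContinuousOn.div (by fun_prop) (by fun_prop) ?_
    rintro q hq
    exact (shell_gauge_pos hq.2).ne'
  exact (Complex.continuous_ofReal.comp_continuousOn hc).smul (by fun_prop)

theorem frontier_shellDomain_subset {p : Cn 2} (hp : p ∈ frontier shellDomain) :
    ‖p 0‖ + ‖p 1‖ = 1 ∨ ‖p 0‖ + ‖p 1‖ = 2 := by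
  rw [isOpen_shellDomain.frontier_eq] at hp
  have hcl : closure shellDomain ⊆ {w : Cn 2 | 1 ≤ ‖w 0‖ + ‖w 1‖ ∧ ‖w 0‖ + ‖w 1‖ ≤ 2} :=
    closure_minimal (fun w hw => ⟨hw.1.le, hw.2.le⟩)
      ((isClosed_le continuous_const continuous_shell_gauge).inter
        (isClosed_le continuous_shell_gauge continuous_const))
  obtain ⟨h1, h2⟩ := hcl hp.1
  by_contra! h
  exact hp.2 ⟨lt_of_le_of_ne h1 h.1.symm, lt_of_le_of_ne h2 h.2⟩

/-! ### Lipschitz boundary -/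

/-- The sublevel set of a Lipschitz function that increases at least linearly in a direction `e`
is the region below the graph of a Lipschitz function. -/
theorem lipschitzBoundaryNear_of_lipschitz {n : ℕ} {D : Set (Cn n)} {p e : Cn n} (he : ‖e‖ = 1)
    {F : Cn n → ℝ} {L : ℝ≥0} {κ : ℝ} (hκ : 0 < κ) (hF : LipschitzWith L F)
    (hmono : ∀ (w : Cn n) (h : ℝ), 0 ≤ h → F w + κ * h ≤ F (w + h • e))
    (hD : ∀ᶠ w in 𝓝 p, (w ∈ D ↔ F w < 0)) : LipschitzBoundaryNear D p := by
  have hroot : ∀ y, ∃ s : ℝ, F (y + s • e) = 0 := by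
    intro y
    have hc : Continuous fun s : ℝ => F (y + s • e) := hF.continuous.comp (by fun_prop)
    -- With this `T`, linear growth forces `F ≤ 0` at `y - T e` and `F ≥ 0` at `y + T e`.
    set T := |F y| / κ with hT
    have hT0 : 0 ≤ T := by positivity
    have hκT : κ * T = |F y| := by rw [hT]; field_simp
    have h1 := hmono y T hT0
    have h2 := hmono (y + (-T) • e) T hT0
    rw [add_assoc, ← add_smul, neg_add_cancel, zero_smul, add_zero] at h2
    have h3 := neg_abs_le (F y)
    have h4 := le_abs_self (F y)
    obtain ⟨s, _, hs⟩ := intermediate_value_Icc (by linarith : -T ≤ T) hc.continuousOn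
      (show (0 : ℝ) ∈ Set.Icc _ _ from ⟨by linarith, by linarith⟩)
    exact ⟨s, hs⟩
  choose f hf using hroot
  have hstrict : ∀ y (s s' : ℝ), s ≤ s' → F (y + s • e) + κ * (s' - s) ≤ F (y + s' • e) := by
    intro y s s' hss
    have := hmono (y + s • e) (s' - s) (by linarith)
    rwa [add_assoc, ← add_smul, add_sub_cancel] at this
  refine ⟨e, he, L / κ.toNNReal, f, ?_, ?_⟩
  · refine LipschitzWith.of_le_add_mul _ fun y y' => ?_
    rcases le_total (f y) (f y') with h | h
    · have : 0 ≤ ((L / κ.toNNReal : ℝ≥0) : ℝ) * dist y y' := by positivity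
      linarith
    · have h1 := hstrict y' _ _ h
      have h2 := hF.dist_le_mul (y' + f y • e) (y + f y • e)
      rw [dist_add_right, hf y, Real.dist_eq, sub_zero, dist_comm] at h2
      have h3 := le_abs_self (F (y' + f y • e))
      rw [hf y'] at h1
      have h4 : f y - f y' ≤ L * dist y y' / κ := by
        rw [le_div_iff₀ hκ]
        linarith
      have h5 : ((L / κ.toNNReal : ℝ≥0) : ℝ) * dist y y' = L * dist y y' / κ := by
        rw [NNReal.coe_div, Real.coe_toNNReal κ hκ.le]
        ring
      linarith
  · filter_upwards [hD] with w hw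
    rw [hw]
    set y := w - (inner ℝ e w) • e with hy
    have hwy : w = y + (inner ℝ e w) • e := by rw [hy, sub_add_cancel]
    constructor
    · intro h
      by_contra! hcon
      have := hstrict y _ _ hcon
      rw [hf y, ← hwy] at this
      nlinarith
    · intro h
      have := hstrict y _ _ h.le
      rw [hf y, ← hwy] at this
      nlinarith

/-- The supremum of the real-linear functionals `ζ ↦ Re (a ζ)` with `‖a‖ ≤ 1` and `Re a ≥ 1 / 2`:
a modification of the modulus that increases along the real direction everywhere. -/
noncomputable def sectorNorm (ζ : ℂ) : ℝ :=
  sSup ((fun a : ℂ => (a * ζ).re) '' {a : ℂ | ‖a‖ ≤ 1 ∧ 1 / 2 ≤ a.re})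

theorem re_mul_le_norm {a : ℂ} (ha : ‖a‖ ≤ 1) (ζ : ℂ) : (a * ζ).re ≤ ‖ζ‖ := by
  refine (Complex.re_le_norm _).trans ?_
  rw [norm_mul]
  exact mul_le_of_le_one_left (norm_nonneg _) ha

theorem le_sectorNorm {a : ℂ} (ha : ‖a‖ ≤ 1) (ha' : 1 / 2 ≤ a.re) (ζ : ℂ) :
    (a * ζ).re ≤ sectorNorm ζ := by
  refine le_csSup ⟨‖ζ‖, ?_⟩ ⟨a, ⟨ha, ha'⟩, rfl⟩
  rintro _ ⟨b, hb, rfl⟩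
  exact re_mul_le_norm hb.1 ζ

theorem sectorNorm_le {ζ : ℂ} {B : ℝ}
    (h : ∀ a : ℂ, ‖a‖ ≤ 1 → 1 / 2 ≤ a.re → (a * ζ).re ≤ B) : sectorNorm ζ ≤ B := by
  refine csSup_le ⟨_, 1, ⟨by simp, by norm_num⟩, rfl⟩ ?_
  rintro _ ⟨a, ha, rfl⟩
  exact h a ha.1 ha.2

theorem sectorNorm_le_add (ζ ζ' : ℂ) : sectorNorm ζ ≤ sectorNorm ζ' + ‖ζ - ζ'‖ := by
  refine sectorNorm_le fun a ha ha' => ?_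
  have h1 := le_sectorNorm ha ha' ζ'
  have h2 := re_mul_le_norm ha (ζ - ζ')
  rw [mul_sub, Complex.sub_re] at h2
  linarith

/-- Every functional in the supremum gains `h * Re a ≥ h / 2`. -/
theorem sectorNorm_add_ofReal (ζ : ℂ) {h : ℝ} (hh : 0 ≤ h) :
    sectorNorm ζ + 1 / 2 * h ≤ sectorNorm (ζ + h) := by
  rw [← le_sub_iff_add_le]
  refine sectorNorm_le fun a ha ha' => ?_
  have h1 := le_sectorNorm ha ha' (ζ + h)
  rw [mul_add, Complex.add_re, Complex.re_mul_ofReal] at h1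
  have := mul_le_mul_of_nonneg_right ha' hh
  linarith

/-- The functional norming `ζ`, with `a = conj ζ / ‖ζ‖`, is admissible precisely in this sector. -/
theorem sectorNorm_eq_norm {ζ : ℂ} (hζ : ζ ≠ 0) (h : 1 / 2 * ‖ζ‖ ≤ ζ.re) :
    sectorNorm ζ = ‖ζ‖ := by
  have hpos : 0 < ‖ζ‖ := norm_pos_iff.2 hζ
  refine le_antisymm (sectorNorm_le fun a ha _ => re_mul_le_norm ha ζ) ?_
  have h1 : ‖(starRingEnd ℂ) ζ / (‖ζ‖ : ℂ)‖ ≤ 1 := by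
    simp [div_self hpos.ne']
  have h2 : 1 / 2 ≤ ((starRingEnd ℂ) ζ / (‖ζ‖ : ℂ)).re := by
    rw [Complex.div_ofReal_re, Complex.conj_re, le_div_iff₀ hpos]
    exact h
  have h3 := le_sectorNorm h1 h2 ζ
  have h4 : (starRingEnd ℂ) ζ / (‖ζ‖ : ℂ) * ζ = ((‖ζ‖ : ℝ) : ℂ) := by
    rw [div_mul_eq_mul_div, mul_comm, Complex.mul_conj, Complex.normSq_eq_norm_sq]
    push_cast
    field_simp
  rwa [h4, Complex.ofReal_re] at h3

/-- Near a point `p` with `p i ≠ 0`, the function `‖w i‖ + ‖w j‖` agrees with a Lipschitz function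
that increases at least linearly in some direction. -/
theorem exists_lipschitz_increasing {i j : Fin 2} (hij : i ≠ j) {p : Cn 2} (hp : p i ≠ 0) :
    ∃ (e : Cn 2) (G : Cn 2 → ℝ), ‖e‖ = 1 ∧ LipschitzWith 2 G ∧
      (∀ (w : Cn 2) (h : ℝ), 0 ≤ h → G w + 1 / 2 * h ≤ G (w + h • e)) ∧
      ∀ᶠ w in 𝓝 p, G w = ‖w i‖ + ‖w j‖ := by
  have hpos : 0 < ‖p i‖ := norm_pos_iff.2 hp
  set v : ℂ := p i / ‖p i‖ with hv
  have hv1 : ‖v‖ = 1 := by simp [hv, div_self hpos.ne']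
  have hvv : v * (starRingEnd ℂ) v = 1 := by
    rw [Complex.mul_conj, Complex.normSq_eq_norm_sq, hv1]
    simp
  have hcv : ‖(starRingEnd ℂ) v‖ = 1 := by rw [Complex.norm_conj, hv1]
  -- Multiplying by `conj v` rotates `p i` onto the positive real axis, the interior of the sector
  -- where `sectorNorm` is the modulus. Only coordinate `i` moves along `e`, so the possible kink of
  -- `‖w j‖` is irrelevant.
  refine ⟨EuclideanSpace.single i v, fun w => sectorNorm (w i * (starRingEnd ℂ) v) + ‖w j‖,
    by simp [hv1], ?_, ?_, ?_⟩
  · refine LipschitzWith.of_le_add_mul _ fun w w' => ?_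
    have h1 := sectorNorm_le_add (w i * (starRingEnd ℂ) v) (w' i * (starRingEnd ℂ) v)
    rw [← sub_mul, norm_mul, hcv, mul_one] at h1
    have h2 := norm_sub_norm_le (w j) (w' j)
    have h3 : ‖(w - w') i‖ ≤ ‖w - w'‖ := PiLp.norm_apply_le _ i
    have h4 : ‖(w - w') j‖ ≤ ‖w - w'‖ := PiLp.norm_apply_le _ j
    simp only [PiLp.sub_apply] at h3 h4
    rw [dist_eq_norm]
    push_cast
    linarith
  · intro w h hh
    have h1 : (w + h • EuclideanSpace.single i v) i * (starRingEnd ℂ) v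
        = w i * (starRingEnd ℂ) v + (h : ℂ) := by
      simp [add_mul, mul_assoc, hvv]
    have h2 : (w + h • EuclideanSpace.single i v) j = w j := by
      simp [hij.symm]
    simp only [h1, h2]
    have := sectorNorm_add_ofReal (w i * (starRingEnd ℂ) v) hh
    linarith
  · have hc : Continuous fun w : Cn 2 => w i * (starRingEnd ℂ) v := by fun_prop
    have hval : p i * (starRingEnd ℂ) v = ((‖p i‖ : ℝ) : ℂ) := by
      rw [hv, map_div₀, Complex.conj_ofReal, mul_div_assoc', Complex.mul_conj,
        Complex.normSq_eq_norm_sq]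
      push_cast
      field_simp
    have hlt : 1 / 2 * ‖p i * (starRingEnd ℂ) v‖ < (p i * (starRingEnd ℂ) v).re := by
      rw [hval, Complex.norm_real, Complex.ofReal_re, norm_norm]
      linarith
    have h1 : ∀ᶠ w : Cn 2 in 𝓝 p, 1 / 2 * ‖w i * (starRingEnd ℂ) v‖ <
        (w i * (starRingEnd ℂ) v).re :=
      (continuous_const.mul hc.norm).continuousAt.eventually_lt
        (Complex.continuous_re.comp hc).continuousAt hlt
    filter_upwards [h1] with w hw
    have hne : w i * (starRingEnd ℂ) v ≠ 0 := by
      intro h0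
      simp [h0] at hw
    rw [sectorNorm_eq_norm hne hw.le, norm_mul, hcv, mul_one]

theorem lipschitzBoundaryNear_shellDomain {p : Cn 2} (hp : p ∈ frontier shellDomain) :
    LipschitzBoundaryNear shellDomain p := by
  have hlim := continuous_shell_gauge.tendsto p
  obtain ⟨e, G, he, hG, hmono, hev⟩ : ∃ (e : Cn 2) (G : Cn 2 → ℝ), ‖e‖ = 1 ∧ LipschitzWith 2 G ∧
      (∀ (w : Cn 2) (h : ℝ), 0 ≤ h → G w + 1 / 2 * h ≤ G (w + h • e)) ∧
      ∀ᶠ w in 𝓝 p, G w = ‖w 0‖ + ‖w 1‖ := by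
    by_cases h0 : p 0 = 0
    · have h1 : p 1 ≠ 0 := by
        intro h1
        have := frontier_shellDomain_subset hp
        simp [h0, h1] at this
      obtain ⟨e, G, he, hG, hmono, hev⟩ :=
        exists_lipschitz_increasing (i := 1) (j := 0) (by simp) h1
      exact ⟨e, G, he, hG, hmono, hev.mono fun w hw => by rw [hw, add_comm]⟩
    · exact exists_lipschitz_increasing (by simp) h0
  rcases frontier_shellDomain_subset hp with h | h
  -- At the inner boundary the domain lies where the gauge is large, so both the function and the
  -- direction are reversed.
  · refine lipschitzBoundaryNear_of_lipschitz (e := -e) (F := fun w => 1 - G w) (L := 2)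
      (κ := 1 / 2) (by rwa [norm_neg]) (by norm_num) ?_ ?_ ?_
    · refine LipschitzWith.of_dist_le_mul fun w w' => ?_
      rw [dist_sub_left]
      exact hG.dist_le_mul w w'
    · intro w t ht
      have := hmono (w + t • -e) t ht
      rw [add_assoc, ← smul_add, neg_add_cancel, smul_zero, add_zero] at this
      linarith
    · rw [h] at hlim
      filter_upwards [hev, hlim.eventually_lt_const (by norm_num : (1 : ℝ) < 2)] with w hw hw2
      rw [hw]
      exact ⟨fun hwD => by linarith [hwD.1], fun h' => ⟨by linarith, hw2⟩⟩
  · refine lipschitzBoundaryNear_of_lipschitz (e := e) (F := fun w => G w - 2) (L := 2)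
      (κ := 1 / 2) he (by norm_num) ?_ ?_ ?_
    · refine LipschitzWith.of_dist_le_mul fun w w' => ?_
      rw [dist_sub_right]
      exact hG.dist_le_mul w w'
    · intro w t ht
      have := hmono w t ht
      linarith
    · rw [h] at hlim
      filter_upwards [hev, hlim.eventually_const_lt (by norm_num : (1 : ℝ) < 2)] with w hw hw2
      rw [hw]
      exact ⟨fun hwD => by linarith [hwD.2], fun h' => ⟨hw2, by linarith⟩⟩

/-! ### Hessians, Levi forms and the Sibony bound -/

/-- At a zero minimum, a `C²` function grows at most quadratically. -/
theorem ContDiffAt.exists_le_mul_norm_sq {E : Type*} [NormedAddCommGroup E] [NormedSpace ℝ E]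
    {v : E → ℝ} {z : E} (hv : ContDiffAt ℝ 2 v z) (hz : v z = 0) (hnn : ∀ᶠ w in 𝓝 z, 0 ≤ v w) :
    ∃ L : ℝ, 0 < L ∧ ∀ᶠ w in 𝓝 z, v w ≤ L * ‖w - z‖ ^ 2 := by
  have hmin : fderiv ℝ v z = 0 :=
    IsLocalMin.fderiv_eq_zero (hnn.mono fun w hw => by rwa [hz])
  obtain ⟨K, s, hs, hK⟩ := (hv.fderiv_right (m := 1) (by norm_num)).exists_lipschitzOnWith
  have hdiff : ∀ᶠ w in 𝓝 z, DifferentiableAt ℝ v w :=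
    (hv.eventually (by simp)).mono fun w hw => hw.differentiableAt (by norm_num)
  obtain ⟨r, hr, hball⟩ := Metric.eventually_nhds_iff_ball.1 (hdiff.and hs)
  -- The derivative vanishes at `z` and is `K`-Lipschitz nearby, so the mean value inequality gives
  -- the constant `K`; the added `1` only ensures positivity.
  refine ⟨K + 1, by positivity, ?_⟩
  filter_upwards [Metric.ball_mem_nhds z hr] with w hw
  have hseg : ∀ y ∈ Metric.closedBall z ‖w - z‖, y ∈ Metric.ball z r := fun y hy =>
    (Metric.mem_closedBall.1 hy).trans_lt (by rw [← dist_eq_norm]; exact hw)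
  have hbound := (convex_closedBall z ‖w - z‖).norm_image_sub_le_of_norm_fderiv_le (𝕜 := ℝ)
    (f := v) (C := K * ‖w - z‖) (fun y hy => (hball y (hseg y hy)).1) (by
      intro y hy
      have h1 := hK.dist_le_mul y (hball y (hseg y hy)).2 z (mem_of_mem_nhds hs)
      rw [hmin, dist_zero_right] at h1
      exact h1.trans (mul_le_mul_of_nonneg_left hy K.2))
    (Metric.mem_closedBall_self (norm_nonneg _)) (by simp [dist_eq_norm] : w ∈ _)
  rw [hz, sub_zero] at hbound
  have h2 := (Real.le_norm_self _).trans hbound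
  nlinarith [sq_nonneg ‖w - z‖]

/-- Subtracting `M s²` along the line leaves a function with a local maximum at `0`. A positive
second derivative would make `0` a local minimum too, so the function would be locally constant, a
contradiction. -/
theorem ContDiffAt.hessian_le {E : Type*} [NormedAddCommGroup E] [NormedSpace ℝ E]
    {v : E → ℝ} {z Y : E} {M : ℝ} (hv : ContDiffAt ℝ 2 v z) (hz : v z = 0)
    (hle : ∀ᶠ s : ℝ in 𝓝 0, v (z + s • Y) ≤ M * s ^ 2) :
    fderiv ℝ (fderiv ℝ v) z Y Y ≤ 2 * M := by
  set g : ℝ → ℝ := fun s => v (z + s • Y) - M * s ^ 2 with hg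
  have hline : ∀ s : ℝ, HasDerivAt (fun s : ℝ => z + s • Y) Y s := fun s => by
    simpa using ((hasDerivAt_id s).smul_const Y).const_add z
  have hcont : Continuous fun s : ℝ => z + s • Y := by fun_prop
  have hlim : Tendsto (fun s : ℝ => z + s • Y) (𝓝 0) (𝓝 z) := by
    simpa using hcont.tendsto 0
  have hsq : ∀ s : ℝ, HasDerivAt (fun s : ℝ => M * s ^ 2) (2 * M * s) s := fun s =>
    ((hasDerivAt_pow 2 s).const_mul M).congr_deriv (by push_cast; ring)
  have hderiv : ∀ᶠ s : ℝ in 𝓝 0, HasDerivAt g (fderiv ℝ v (z + s • Y) Y - 2 * M * s) s := by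
    filter_upwards [hlim.eventually (hv.eventually (by simp))] with s hs
    exact ((hs.differentiableAt (by norm_num)).hasFDerivAt.comp_hasDerivAt s (hline s)).sub (hsq s)
  have hFz : HasFDerivAt (fderiv ℝ v) (fderiv ℝ (fderiv ℝ v) z) z :=
    ((hv.fderiv_right (m := 1) (by norm_num)).differentiableAt (by norm_num)).hasFDerivAt
  have hFY : HasFDerivAt (fun w => fderiv ℝ v w Y) ((fderiv ℝ (fderiv ℝ v) z).flip Y)
      (z + (0 : ℝ) • Y) := by
    simpa using hFz.clm_apply (hasFDerivAt_const Y z)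
  have hd1 : deriv g =ᶠ[𝓝 0] fun s => fderiv ℝ v (z + s • Y) Y - 2 * M * s :=
    hderiv.mono fun s hs => hs.deriv
  have hd2 : deriv (deriv g) 0 = fderiv ℝ (fderiv ℝ v) z Y Y - 2 * M := by
    rw [hd1.deriv_eq]
    have h1 : HasDerivAt (fun s : ℝ => fderiv ℝ v (z + s • Y) Y)
        ((fderiv ℝ (fderiv ℝ v) z).flip Y Y) 0 := by
      have h := hFY.comp_hasDerivAt (0 : ℝ) (hline 0)
      exact h
    have h2 : HasDerivAt (fun s : ℝ => 2 * M * s) (2 * M) 0 := by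
      simpa using (hasDerivAt_id (0 : ℝ)).const_mul (2 * M)
    exact (h1.sub h2).deriv
  have hg0 : g 0 = 0 := by simp [hg, hz]
  have hmax : IsLocalMax g 0 := by
    filter_upwards [hle] with s hs
    rw [hg0]
    simp only [hg]
    linarith
  by_contra! hcon
  have hmin : IsLocalMin g 0 := isLocalMin_of_deriv_deriv_pos (by rw [hd2]; linarith)
    hmax.deriv_eq_zero hderiv.self_of_nhds.continuousAt
  have heq : g =ᶠ[𝓝 0] fun _ => g 0 := (hmax.and hmin).mono fun s hs => le_antisymm hs.1 hs.2
  have h1 := heq.deriv.deriv_eq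
  simp at h1
  linarith

theorem wirtinger_wirtingerBar {n : ℕ} {v : Cn n → ℝ} {z : Cn n} (hv : ContDiffAt ℝ 2 v z)
    (j k : Fin n) :
    wirtinger j (wirtingerBar k (fun w => (v w : ℂ))) z = (1 / 4) *
      ((fderiv ℝ (fderiv ℝ v) z (EuclideanSpace.single j 1) (EuclideanSpace.single k 1) : ℂ)
      + fderiv ℝ (fderiv ℝ v) z (EuclideanSpace.single j Complex.I)
          (EuclideanSpace.single k Complex.I)
      + Complex.I * (fderiv ℝ (fderiv ℝ v) z (EuclideanSpace.single j 1)
          (EuclideanSpace.single k Complex.I)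
        - fderiv ℝ (fderiv ℝ v) z (EuclideanSpace.single j Complex.I)
          (EuclideanSpace.single k 1))) := by
  set B := fderiv ℝ (fderiv ℝ v) z with hB
  have hF : HasFDerivAt (fderiv ℝ v) B z :=
    ((hv.fderiv_right (m := 1) (by norm_num)).differentiableAt (by norm_num)).hasFDerivAt
  have hfirst : wirtingerBar k (fun w => (v w : ℂ)) =ᶠ[𝓝 z] fun w =>
      (1 / 2 : ℂ) * ((fderiv ℝ v w (EuclideanSpace.single k 1) : ℂ)
        + Complex.I * (fderiv ℝ v w (EuclideanSpace.single k Complex.I) : ℂ)) := by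
    filter_upwards [hv.eventually (by simp)] with w hw
    have h1 : HasFDerivAt (fun w => (v w : ℂ)) (Complex.ofRealCLM.comp (fderiv ℝ v w)) w :=
      Complex.ofRealCLM.hasFDerivAt.comp w (hw.differentiableAt (by norm_num)).hasFDerivAt
    simp [wirtingerBar, h1.fderiv]
  have happ : ∀ a : Cn n, HasFDerivAt (fun w => (fderiv ℝ v w a : ℂ))
      (Complex.ofRealCLM.comp (B.flip a)) z := by
    intro a
    have h1 : HasFDerivAt (fun w => fderiv ℝ v w a) (B.flip a) z := by
      simpa using hF.clm_apply (hasFDerivAt_const a z)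
    exact Complex.ofRealCLM.hasFDerivAt.comp z h1
  have hsecond := ((happ (EuclideanSpace.single k 1)).add
    ((happ (EuclideanSpace.single k Complex.I)).const_mul Complex.I)).const_mul (1 / 2 : ℂ)
  have h2 := hfirst.fderiv_eq.trans hsecond.fderiv
  simp only [wirtinger, h2]
  simp
  linear_combination (-(1 / 4 : ℂ) * B (EuclideanSpace.single j Complex.I)
    (EuclideanSpace.single k Complex.I)) * Complex.I_sq

/-- The Levi form in terms of the real Hessian. -/
theorem leviForm_eq_hessian {n : ℕ} {v : Cn n → ℝ} {z : Cn n} (hv : ContDiffAt ℝ 2 v z)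
    (X : Cn n) :
    leviForm v z X = (fderiv ℝ (fderiv ℝ v) z X X
      + fderiv ℝ (fderiv ℝ v) z (Complex.I • X) (Complex.I • X)) / 4 := by
  set B := fderiv ℝ (fderiv ℝ v) z with hB
  have hdecomp : ∀ Y : Cn n, Y = ∑ j, ((Y j).re • EuclideanSpace.single j (1 : ℂ)
      + (Y j).im • EuclideanSpace.single j Complex.I) := by
    intro Y
    ext i
    simp [Pi.single_apply, Finset.sum_add_distrib]
  have hBB : ∀ Y : Cn n, B Y Y = ∑ j, ∑ k,
      ((Y j).re * (Y k).re * B (EuclideanSpace.single j 1) (EuclideanSpace.single k 1)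
      + (Y j).re * (Y k).im * B (EuclideanSpace.single j 1) (EuclideanSpace.single k Complex.I)
      + (Y j).im * (Y k).re * B (EuclideanSpace.single j Complex.I) (EuclideanSpace.single k 1)
      + (Y j).im * (Y k).im * B (EuclideanSpace.single j Complex.I)
          (EuclideanSpace.single k Complex.I)) := by
    intro Y
    conv_lhs => rw [hdecomp Y]
    rw [map_sum B, sum_apply]
    refine Finset.sum_congr rfl fun j _ => ?_
    rw [map_sum]
    refine Finset.sum_congr rfl fun k _ => ?_
    simp only [map_add, map_smul, add_apply, smul_apply,
      smul_eq_mul]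
    ring
  rw [hBB, hBB, leviForm, Complex.re_sum, ← Finset.sum_add_distrib, Finset.sum_div]
  refine Finset.sum_congr rfl fun j _ => ?_
  rw [Complex.re_sum, ← Finset.sum_add_distrib, Finset.sum_div]
  refine Finset.sum_congr rfl fun k _ => ?_
  rw [wirtinger_wirtingerBar hv]
  simp [← hB]
  ring

theorem axisPoint_mem_shellDomain {x : ℝ} (hx1 : 1 < x) (hx2 : x < 2) :
    axisPoint x ∈ shellDomain := by
  constructor <;> simpa [abs_of_pos (by linarith : 0 < x)]

theorem leviForm_le_of_mem_sibonyClass {x : ℝ} (hx1 : 1 < x) (hx2 : x < 2) {X : Cn 2}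
    (hX : X ≠ 0) {v : Cn 2 → ℝ} (hv : v ∈ sibonyClass shellDomain (axisPoint x)) :
    leviForm v (axisPoint x) X ≤ (4 * ‖X‖ / (2 - x)) ^ 2 := by
  obtain ⟨hv01, hvz, hpsh, hC2⟩ := hv
  have hmem := isOpen_shellDomain.mem_nhds (axisPoint_mem_shellDomain hx1 hx2)
  obtain ⟨L, hL, hgrowth⟩ := hC2.exists_le_mul_norm_sq hvz
    (Filter.mem_of_superset hmem fun w hw => (hv01 w hw).1)
  have hneg : ∀ w ∈ shellDomain, elog (v w) ≤ 0 := by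
    intro w hw
    rw [elog, ENNReal.log_le_zero_iff]
    exact ENNReal.ofReal_le_one.2 (hv01 w hw).2.le
  have hpole : ∀ᶠ w in 𝓝[≠] axisPoint x,
      elog (v w) ≤ ((2 * Real.log ‖w - axisPoint x‖ + Real.log L : ℝ) : EReal) := by
    filter_upwards [nhdsWithin_le_nhds hgrowth, self_mem_nhdsWithin] with w hw hw0
    have hpos : 0 < ‖w - axisPoint x‖ := norm_pos_iff.2 (sub_ne_zero.2 hw0)
    have h1 : elog (v w) ≤ elog (L * ‖w - axisPoint x‖ ^ 2) :=
      ENNReal.log_le_log (ENNReal.ofReal_le_ofReal hw)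
    refine h1.trans (le_of_eq ?_)
    rw [elog, ENNReal.log_ofReal_of_pos (by positivity), Real.log_mul hL.ne' (by positivity),
      Real.log_pow, add_comm]
    rfl
  have hXpos : 0 < ‖X‖ := norm_pos_iff.2 hX
  -- Needed for `Y = X` and `Y = iX`: the Levi form is a quarter of the sum of the two Hessian
  -- values, each at most twice the constant here.
  have hmodel : ∀ Y : Cn 2, ‖Y‖ = ‖X‖ → ∀ᶠ s : ℝ in 𝓝 0,
      v (axisPoint x + s • Y) ≤ (4 * ‖X‖ / (2 - x)) ^ 2 * s ^ 2 := by
    intro Y hY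
    have hball : ∀ r : ℝ, 0 < r → ∀ᶠ s : ℝ in 𝓝 0, ‖(s : ℂ)‖ < r := fun r hr => by
      filter_upwards [Metric.ball_mem_nhds (0 : ℝ) hr] with s hs
      simpa using hs
    filter_upwards [hball ((x - 1) / ‖X‖) (by apply div_pos <;> linarith),
      hball ((2 - x) / (4 * ‖X‖)) (by apply div_pos <;> linarith)] with s hs1 hs2
    rcases eq_or_ne s 0 with rfl | hs0
    · simp [hvz]
    have hY0 : Y ≠ 0 := norm_pos_iff.1 (by rwa [hY])
    have h := hpsh.le_log_near_axisPoint hneg hx1 hpole hY0 (Complex.ofReal_ne_zero.2 hs0)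
      (by rwa [hY]) (by rwa [hY])
    rw [hY, Complex.norm_real, Complex.coe_smul] at h
    have hspos : 0 < ‖s‖ := norm_pos_iff.2 hs0
    have hpos : 0 < 4 * ‖X‖ * ‖s‖ / (2 - x) := div_pos (by positivity) (by linarith)
    have h2 : ((2 * Real.log (4 * ‖X‖ * ‖s‖ / (2 - x)) : ℝ) : EReal)
        = ENNReal.log (ENNReal.ofReal ((4 * ‖X‖ * ‖s‖ / (2 - x)) ^ 2)) := by
      rw [ENNReal.log_ofReal_of_pos (by positivity), Real.log_pow]
      rfl
    rw [h2, elog, ENNReal.log_le_log_iff, ENNReal.ofReal_le_ofReal_iff (by positivity)] at h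
    refine h.trans (le_of_eq ?_)
    rw [← sq_abs s, ← Real.norm_eq_abs]
    ring
  have h1 := hC2.hessian_le hvz (hmodel X rfl)
  have h2 := hC2.hessian_le hvz (hmodel (Complex.I • X) (by simp [norm_smul]))
  rw [leviForm_eq_hessian hC2]
  linarith

theorem sibony_shellDomain_axisPoint_le {x : ℝ} (hx1 : 1 < x) (hx2 : x < 2) {X : Cn 2}
    (hX : X ≠ 0) :
    sibony shellDomain (axisPoint x) X ≤ ENNReal.ofReal (4 * ‖X‖ / (2 - x)) := by
  refine iSup₂_le fun v hv => ENNReal.ofReal_le_ofReal ?_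
  exact Real.sqrt_le_iff.2 ⟨div_nonneg (by positivity) (by linarith),
    leviForm_le_of_mem_sibonyClass hx1 hx2 hX hv⟩

/-! ### Indicatrix volumes and the conclusion -/

theorem exists_volume_le_of_metric_le {M : ℝ → Cn 2 → ℝ≥0∞}
    (hM : ∀ x : ℝ, 1 < x → x < 2 → ∀ X : Cn 2, X ≠ 0 →
      M x X ≤ ENNReal.ofReal (4 * ‖X‖ / (2 - x))) :
    ∃ c : ℝ≥0∞, 0 < c ∧ ∀ᶠ x : ℝ in 𝓝[>] 1, c ≤ volume {X : Cn 2 | M x X < 1} := by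
  -- For `x < 3 / 2` the metric is at most `8‖X‖`, so any radius up to `1 / 8` works; the origin is
  -- removed because the bound assumes `X ≠ 0`.
  refine ⟨volume (Metric.ball (0 : Cn 2) (1 / 9) ∩ {0}ᶜ), ?_, ?_⟩
  · refine (Metric.isOpen_ball.inter isOpen_compl_singleton).measure_pos _
      ⟨EuclideanSpace.single 0 (1 / 10), ?_, ?_⟩
    · rw [mem_ball_zero_iff]
      simp
      norm_num
    · simp
  · filter_upwards [Ioo_mem_nhdsGT (by norm_num : (1 : ℝ) < 3 / 2)] with x hx
    refine measure_mono fun X hX => ?_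
    refine (hM x hx.1 (by linarith [hx.2]) X hX.2).trans_lt ?_
    have h1 := mem_ball_zero_iff.1 hX.1
    rw [ENNReal.ofReal_lt_one, div_lt_one (by linarith [hx.2])]
    linarith [hx.2]

theorem tendsto_axisPoint_nhdsWithin :
    Tendsto axisPoint (𝓝[>] 1) (𝓝[shellDomain] (axisPoint 1)) := by
  refine tendsto_nhdsWithin_iff.2 ⟨?_, ?_⟩
  · have hc : Continuous axisPoint := by
      unfold axisPoint
      fun_prop
    exact (hc.tendsto 1).mono_left nhdsWithin_le_nhds
  · filter_upwards [Ioo_mem_nhdsGT (by norm_num : (1 : ℝ) < 2)] with x hx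
    exact axisPoint_mem_shellDomain hx.1 hx.2

theorem not_tendsto_zero_of_eventually_le {V : Cn 2 → ℝ≥0∞} {c : ℝ≥0∞} (hc : 0 < c)
    (h : ∀ᶠ x : ℝ in 𝓝[>] 1, c ≤ V (axisPoint x)) :
    ¬ Tendsto V (𝓝[shellDomain] (axisPoint 1)) (𝓝 0) := fun ht =>
  hc.not_ge (ge_of_tendsto (ht.comp tendsto_axisPoint_nhdsWithin) h)

theorem axisPoint_one_mem_frontier : axisPoint 1 ∈ frontier shellDomain := by
  rw [isOpen_shellDomain.frontier_eq]
  refine ⟨mem_closure_of_tendsto (tendsto_axisPoint_nhdsWithin.mono_right nhdsWithin_le_nhds) ?_,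
    fun h => ?_⟩
  · exact (tendsto_nhdsWithin_iff.1 tendsto_axisPoint_nhdsWithin).2
  · have := h.1
    simp at this

theorem mainTheorem6 :
    -- `D` is a bounded domain with Lipschitz boundary, and `(1, 0)` is a boundary point
    (IsOpen shellDomain ∧ IsConnected shellDomain ∧ Bornology.IsBounded shellDomain ∧
      (∀ p ∈ frontier shellDomain, LipschitzBoundaryNear shellDomain p) ∧
      axisPoint 1 ∈ frontier shellDomain) ∧
    -- the Azukawa metric at `(x, 0)` stays bounded as `x → 1⁺`, uniformly in unit vectors
    (∃ C : ℝ≥0, ∀ᶠ x : ℝ in 𝓝[>] 1, ∀ X : Cn 2, ‖X‖ = 1 →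
      azukawa shellDomain (axisPoint x) X ≤ (C : ℝ≥0∞)) ∧
    -- the volumes of the indicatrices stay away from zero
    0 < liminf (fun x : ℝ => volAzukawa shellDomain (axisPoint x)) (𝓝[>] 1) ∧
    -- neither indicatrix volume tends to zero at the Lipschitz boundary point `(1, 0)`
    ¬ Tendsto (volAzukawa shellDomain) (𝓝[shellDomain] (axisPoint 1)) (𝓝 0) ∧
    ¬ Tendsto (volSibony shellDomain) (𝓝[shellDomain] (axisPoint 1)) (𝓝 0) := by
  obtain ⟨c, hc, hcv⟩ := exists_volume_le_of_metric_le
    fun x hx1 hx2 X hX => azukawa_shellDomain_axisPoint_le hx1 hx2 hX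
  obtain ⟨c', hc', hcv'⟩ := exists_volume_le_of_metric_le
    fun x hx1 hx2 X hX => sibony_shellDomain_axisPoint_le hx1 hx2 hX
  refine ⟨⟨isOpen_shellDomain, isConnected_shellDomain, isBounded_shellDomain,
    fun p hp => lipschitzBoundaryNear_shellDomain hp, axisPoint_one_mem_frontier⟩, ⟨8, ?_⟩,
    hc.trans_le (le_liminf_of_le (h := hcv)), not_tendsto_zero_of_eventually_le hc hcv,
    not_tendsto_zero_of_eventually_le hc' hcv'⟩
  filter_upwards [Ioo_mem_nhdsGT (by norm_num : (1 : ℝ) < 3 / 2)] with x hx X hX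
  have hX0 : X ≠ 0 := norm_pos_iff.1 (by rw [hX]; norm_num)
  refine (azukawa_shellDomain_axisPoint_le hx.1 (by linarith [hx.2]) hX0).trans ?_
  rw [hX]
  refine ENNReal.ofReal_le_of_le_toReal ?_
  have : 4 * 1 / (2 - x) ≤ 8 := by
    rw [div_le_iff₀ (by linarith [hx.2])]
    linarith [hx.2]
  simpa using this
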